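/- Tile $\mathbb{R}^2$ by unit squares $S_{(i,j)}$, $(i,j)\in\mathbb{Z}^2$, where $S_{(i,j)}$ is the square with centre $(i,j)$ and sides parallel to the axes, and let every square be either occupied or vacant. Two distinct squares are plus-adjacent if they share an edge. Suppose that the square $S_{(0,0)}$ is occupied, and let $C^+(0)$ be its plus-connected component, i.e. the set of all squares that can be reached from $S_{(0,0)}$ through a finite sequence of occupied squares, each plus-adjacent to the previous one. Let $G^+_C$ be the graph whose vertices are the corners, and whose edges are the edges, of the squares in $C^+(0)$. A cycle in $G^+_C$ is a closed path without repeated vertices (of length at least $3$), identified with its set of edges; its interior and exterior are the bounded and the unbounded part of the complement in $\mathbb{R}^2$ of the closed curve that it traces. A square lies in the interior (exterior) of a cycle if the open square does, and an edge lies in the exterior if the edge without its end points does. An edge of $G^+_C$ is a boundary edge if it is an edge of an occupied square and of a vacant square. The outermost boundary $\partial^+_0$ of $C^+(0)$ is the set of all edges $e$ of $G^+_C$ such that, for every cycle $C$ in $G^+_C$, either $e$ is an edge of $C$ or $e$ lies in the exterior of $C$. Theorem. Suppose that $C^+(0)$ is finite. Then $\partial^+_0$ is (the edge set of) a cycle $C^+_{out}$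 in $G^+_C$ with the following properties: (i) all squares of $C^+(0)$ are contained in the interior of $C^+_{out}$; (ii) every edge of $C^+_{out}$ is a boundary edge that is an edge of an occupied square of $C^+(0)$ lying in the interior of $C^+_{out}$ and of a vacant square lying in the exterior of $C^+_{out}$. Moreover, $C^+_{out}$ is the unique cycle in $G^+_C$ that satisfies (i) and (ii). -/

import Mathlib

namespace PlusPercolation

/-- The squares of the tiling: `(i, j)` stands for the unit square with centre `(i, j)`. -/
abbrev Square : Type := ℤ × ℤ

/-- The corners of the squares: `(a, b)` stands for the point `(a - 1/2, b - 1/2)` of the plane. -/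
abbrev Vertex : Type := ℤ × ℤ

/-- The point of the plane that a corner stands for. -/
noncomputable def Vertex.point (v : Vertex) : ℝ × ℝ := ((v.1 : ℝ) - 1 / 2, (v.2 : ℝ) - 1 / 2)

/-- The (open) unit square with centre `(i, j)`, as a region of the plane. -/
def openSquare (s : Square) : Set (ℝ × ℝ) :=
  Set.Ioo ((s.1 : ℝ) - 1 / 2) ((s.1 : ℝ) + 1 / 2) ×ˢ
    Set.Ioo ((s.2 : ℝ) - 1 / 2) ((s.2 : ℝ) + 1 / 2)

/-- The four edges (bottom, top, left, right) of a square. -/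
def squareEdges (s : Square) : Set (Sym2 Vertex) :=
  {s((s.1, s.2), (s.1 + 1, s.2)), s((s.1, s.2 + 1), (s.1 + 1, s.2 + 1)),
    s((s.1, s.2), (s.1, s.2 + 1)), s((s.1 + 1, s.2), (s.1 + 1, s.2 + 1))}

/-- Two distinct squares are plus-adjacent if they share an edge. -/
def PlusAdj (s t : Square) : Prop :=
  s ≠ t ∧ ∃ e, e ∈ squareEdges s ∧ e ∈ squareEdges t

/-- Plus-adjacency between occupied squares. -/
def occupiedGraph (occ : Set Square) : SimpleGraph Square where
  Adj s t := s ∈ occ ∧ t ∈ occ ∧ PlusAdj s t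
  symm := ⟨fun _ _ h => ⟨h.2.1, h.1, h.2.2.1.symm, by
    obtain ⟨e, hs, ht⟩ := h.2.2.2
    exact ⟨e, ht, hs⟩⟩⟩
  loopless := ⟨fun _ h => h.2.2.1 rfl⟩

/-- The occupied plus-connected component of the square centred at the origin; it is empty if
that square is vacant. -/
def plusComponent (occ : Set Square) : Set Square :=
  {s | (0, 0) ∈ occ ∧ (occupiedGraph occ).Reachable (0, 0) s}

/-- The graph formed by the corners and edges of the squares in `K`. -/
def cornerGraph (K : Set Square) : SimpleGraph Vertex :=
  SimpleGraph.fromEdgeSet (⋃ s ∈ K, squareEdges s)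

/-- `C` is (the edge set of) a cycle in the graph `G`. -/
def IsCycleIn (G : SimpleGraph Vertex) (C : Set (Sym2 Vertex)) : Prop :=
  ∃ (v : Vertex) (p : G.Walk v v), p.IsCycle ∧ C = {e | e ∈ p.edges}

/-- The closed segment in the plane that an edge stands for. -/
noncomputable def edgeSegment : Sym2 Vertex → Set (ℝ × ℝ) :=
  Sym2.lift ⟨fun u v => segment ℝ u.point v.point, fun u v => segment_symm ℝ u.point v.point⟩

/-- The segment of an edge without its end points. -/
noncomputable def openEdge : Sym2 Vertex → Set (ℝ × ℝ) :=
  Sym2.lift ⟨fun u v => openSegment ℝ u.point v.point,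
    fun u v => openSegment_symm ℝ u.point v.point⟩

/-- The closed curve in the plane traced by the edges of `C`. -/
def trace (C : Set (Sym2 Vertex)) : Set (ℝ × ℝ) :=
  ⋃ e ∈ C, edgeSegment e

/-- The interior of a cycle: the bounded part of the complement of the curve. -/
def interiorOf (C : Set (Sym2 Vertex)) : Set (ℝ × ℝ) :=
  {x | x ∉ trace C ∧ Bornology.IsBounded (connectedComponentIn (trace C)ᶜ x)}

/-- The exterior of a cycle: the unbounded part of the complement of the curve. -/
def exteriorOf (C : Set (Sym2 Vertex)) : Set (ℝ × ℝ) :=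
  {x | x ∉ trace C ∧ ¬ Bornology.IsBounded (connectedComponentIn (trace C)ᶜ x)}

/-- The outermost boundary of `K`: the edges `e` of its graph such that, for every cycle in that
graph, `e` is an edge of the cycle or lies in its exterior. -/
def outermostBoundary (K : Set Square) : Set (Sym2 Vertex) :=
  {e | e ∈ (cornerGraph K).edgeSet ∧
    ∀ C, IsCycleIn (cornerGraph K) C → e ∈ C ∨ openEdge e ⊆ exteriorOf C}

/-- A boundary edge of `K`: an edge of its graph that is an edge of an occupied square and
of a vacant square. -/
def IsBoundaryEdge (occ K : Set Square) (e : Sym2 Vertex) : Prop :=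
  e ∈ (cornerGraph K).edgeSet ∧
    (∃ s, s ∈ occ ∧ e ∈ squareEdges s) ∧ ∃ t, t ∉ occ ∧ e ∈ squareEdges t

/-- All squares of `K` are contained in the interior of `C`. -/
def ContainsSquares (K : Set Square) (C : Set (Sym2 Vertex)) : Prop :=
  ∀ s ∈ K, openSquare s ⊆ interiorOf C

/-- Every edge of `C` is a boundary edge of `K`, and it is an edge of an (occupied) square of `K`
in the interior of `C` and of a vacant square in the exterior of `C`. -/
def SeparatesOccupiedFromVacant (occ K : Set Square) (C : Set (Sym2 Vertex)) : Prop :=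
  ∀ e ∈ C, IsBoundaryEdge occ K e ∧
    (∃ s, s ∈ K ∧ s ∈ occ ∧ e ∈ squareEdges s ∧ openSquare s ⊆ interiorOf C) ∧
    ∃ t, t ∉ occ ∧ e ∈ squareEdges t ∧ openSquare t ⊆ exteriorOf C

end PlusPercolation

namespace PlusPercolation

/-! Let `K` be the component of the origin, and let `D` be `(outside K N)ᶜ`, that is, `K` with its
holes filled in. The outermost boundary turns out to be B = `edgeBoundary D`, the set of edges
between `D` and its complement (`InBox.outermostBoundary_eq`).

B is a cycle (`isCycleIn_edgeBoundary`): it is finite and has no leaves, so it contains some cycle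
C. Parity gives a two-colouring of the squares that changes exactly across C
(`exists_coloring_of_isCycleIn`). Since `D` and its complement are both plus-connected and C runs
between them, each has a single colour. The colours differ, so every edge of B is in C. This
combinatorial argument replaces the Jordan curve theorem.

Two topological facts complete the proof. Squares of `D` lie in the interior of B, because the
closed regions covered by `D` and by its complement meet only on B. Squares of `outside K N` lie in
the exterior of every cycle in the graph of `K`, because they are linked to infinity across edges
that this graph lacks. Every edge of B has a square of `K` on one side and a square of `outside K N`
on the other; this gives (i), (ii) and uniqueness. -/

/-! ### Combinatorics of grid edges and edge boundaries -/

/-- The horizontal edge from `(a, b)` to `(a + 1, b)`. -/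
def horEdge (a b : ℤ) : Sym2 Vertex := s((a, b), (a + 1, b))

/-- The vertical edge from `(a, b)` to `(a, b + 1)`. -/
def verEdge (a b : ℤ) : Sym2 Vertex := s((a, b), (a, b + 1))

theorem mem_squareEdges {s : Square} {e : Sym2 Vertex} :
    e ∈ squareEdges s ↔ e = horEdge s.1 s.2 ∨ e = horEdge s.1 (s.2 + 1) ∨
      e = verEdge s.1 s.2 ∨ e = verEdge (s.1 + 1) s.2 := by
  simp [squareEdges, horEdge, verEdge]

@[simp]
theorem horEdge_inj {a b c d : ℤ} : horEdge a b = horEdge c d ↔ a = c ∧ b = d := by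
  simp only [horEdge, Sym2.eq_iff, Prod.mk.injEq]
  omega

@[simp]
theorem verEdge_inj {a b c d : ℤ} : verEdge a b = verEdge c d ↔ a = c ∧ b = d := by
  simp only [verEdge, Sym2.eq_iff, Prod.mk.injEq]
  omega

@[simp]
theorem horEdge_ne_verEdge {a b c d : ℤ} : horEdge a b ≠ verEdge c d := by
  simp only [horEdge, verEdge, ne_eq, Sym2.eq_iff, Prod.mk.injEq]
  omega

@[simp]
theorem verEdge_ne_horEdge {a b c d : ℤ} : verEdge a b ≠ horEdge c d :=
  horEdge_ne_verEdge.symm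

theorem horEdge_mem_squareEdges {a b : ℤ} {s : Square} :
    horEdge a b ∈ squareEdges s ↔ s = (a, b) ∨ s = (a, b - 1) := by
  obtain ⟨i, j⟩ := s
  simp only [mem_squareEdges, horEdge_inj, horEdge_ne_verEdge, Prod.mk.injEq, or_false]
  grind

theorem verEdge_mem_squareEdges {a b : ℤ} {s : Square} :
    verEdge a b ∈ squareEdges s ↔ s = (a, b) ∨ s = (a - 1, b) := by
  obtain ⟨i, j⟩ := s
  simp only [mem_squareEdges, verEdge_inj, verEdge_ne_horEdge, Prod.mk.injEq, false_or]
  grind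

/-- An edge of the square lattice formed by the corners. -/
def IsGridEdge (e : Sym2 Vertex) : Prop :=
  ∃ a b, e = horEdge a b ∨ e = verEdge a b

theorem IsGridEdge.of_mem_squareEdges {s : Square} {e : Sym2 Vertex} (h : e ∈ squareEdges s) :
    IsGridEdge e := by
  rcases mem_squareEdges.1 h with h | h | h | h
  exacts [⟨_, _, .inl h⟩, ⟨_, _, .inl h⟩, ⟨_, _, .inr h⟩, ⟨_, _, .inr h⟩]

theorem not_isDiag_of_isGridEdge {e : Sym2 Vertex} (h : IsGridEdge e) : ¬ e.IsDiag := by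
  obtain ⟨a, b, rfl | rfl⟩ := h <;> simp [horEdge, verEdge]

theorem mem_edgeSet_cornerGraph {K : Set Square} {e : Sym2 Vertex} :
    e ∈ (cornerGraph K).edgeSet ↔ ∃ s ∈ K, e ∈ squareEdges s := by
  simp only [cornerGraph, SimpleGraph.edgeSet_fromEdgeSet, Set.mem_sdiff, Set.mem_iUnion,
    exists_prop]
  constructor
  · exact fun h => h.1
  · rintro ⟨s, hs, he⟩
    exact ⟨⟨s, hs, he⟩, not_isDiag_of_isGridEdge (.of_mem_squareEdges he)⟩

theorem IsCycleIn.subset_edgeSet {G : SimpleGraph Vertex} {C : Set (Sym2 Vertex)}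
    (h : IsCycleIn G C) : C ⊆ G.edgeSet := by
  obtain ⟨v, p, -, rfl⟩ := h
  exact fun e he => p.edges_subset_edgeSet he

theorem plusAdj_iff {s t : Square} :
    PlusAdj s t ↔ (s.1 = t.1 ∧ (s.2 = t.2 + 1 ∨ t.2 = s.2 + 1)) ∨
      (s.2 = t.2 ∧ (s.1 = t.1 + 1 ∨ t.1 = s.1 + 1)) := by
  obtain ⟨i, j⟩ := s
  obtain ⟨k, l⟩ := t
  constructor
  · rintro ⟨hne, e, hs, ht⟩
    obtain ⟨a, b, rfl | rfl⟩ := IsGridEdge.of_mem_squareEdges hs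
    · simp only [horEdge_mem_squareEdges, Prod.mk.injEq, ne_eq] at hs ht hne
      simp only
      omega
    · simp only [verEdge_mem_squareEdges, Prod.mk.injEq, ne_eq] at hs ht hne
      simp only
      omega
  · intro h
    refine ⟨by simp only [ne_eq, Prod.mk.injEq]; simp only at h; omega, ?_⟩
    simp only at h
    rcases h with ⟨rfl, rfl | rfl⟩ | ⟨rfl, rfl | rfl⟩
    · exact ⟨horEdge i (l + 1), by simp [horEdge_mem_squareEdges],
        by simp [horEdge_mem_squareEdges]⟩
    · exact ⟨horEdge i (j + 1), by simp [horEdge_mem_squareEdges],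
        by simp [horEdge_mem_squareEdges]⟩
    · exact ⟨verEdge (k + 1) j, by simp [verEdge_mem_squareEdges],
        by simp [verEdge_mem_squareEdges]⟩
    · exact ⟨verEdge (i + 1) j, by simp [verEdge_mem_squareEdges],
        by simp [verEdge_mem_squareEdges]⟩

/-- The edges between a square of `D` and a square outside `D`. -/
def edgeBoundary (D : Set Square) : Set (Sym2 Vertex) :=
  {e | ∃ s t, s ∈ D ∧ t ∉ D ∧ e ∈ squareEdges s ∧ e ∈ squareEdges t}

theorem horEdge_mem_edgeBoundary {D : Set Square} {a b : ℤ} :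
    horEdge a b ∈ edgeBoundary D ↔ ¬ ((a, b) ∈ D ↔ (a, b - 1) ∈ D) := by
  simp only [edgeBoundary, Set.mem_ofPred_eq, horEdge_mem_squareEdges]
  constructor
  · rintro ⟨s, t, hs, ht, rfl | rfl, rfl | rfl⟩ <;> tauto
  · intro h
    by_cases h1 : (a, b) ∈ D
    · exact ⟨_, _, h1, fun h2 => h (iff_of_true h1 h2), .inl rfl, .inr rfl⟩
    · exact ⟨_, _, by tauto, h1, .inr rfl, .inl rfl⟩

theorem verEdge_mem_edgeBoundary {D : Set Square} {a b : ℤ} :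
    verEdge a b ∈ edgeBoundary D ↔ ¬ ((a, b) ∈ D ↔ (a - 1, b) ∈ D) := by
  simp only [edgeBoundary, Set.mem_ofPred_eq, verEdge_mem_squareEdges]
  constructor
  · rintro ⟨s, t, hs, ht, rfl | rfl, rfl | rfl⟩ <;> tauto
  · intro h
    by_cases h1 : (a, b) ∈ D
    · exact ⟨_, _, h1, fun h2 => h (iff_of_true h1 h2), .inl rfl, .inr rfl⟩
    · exact ⟨_, _, by tauto, h1, .inr rfl, .inl rfl⟩

theorem IsGridEdge.of_mem_edgeBoundary {D : Set Square} {e : Sym2 Vertex}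
    (h : e ∈ edgeBoundary D) : IsGridEdge e := by
  obtain ⟨s, t, -, -, h, -⟩ := h
  exact .of_mem_squareEdges h

/-! ### Topology of squares and edges -/

theorem mem_edgeSegment_horEdge {a b : ℤ} {x : ℝ × ℝ} :
    x ∈ edgeSegment (horEdge a b) ↔
      (a : ℝ) - 1 / 2 ≤ x.1 ∧ x.1 ≤ a + 1 / 2 ∧ x.2 = b - 1 / 2 := by
  obtain ⟨x, y⟩ := x
  simp only [edgeSegment, horEdge, Sym2.lift_mk, Vertex.point]
  rw [← Prod.image_mk_segment_left, segment_eq_Icc (by push_cast; linarith)]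
  constructor
  · rintro ⟨z, ⟨hz, hz'⟩, h⟩
    obtain ⟨rfl, rfl⟩ := Prod.mk.inj h
    push_cast at hz'
    exact ⟨by linarith, by linarith, rfl⟩
  · rintro ⟨h1, h2, rfl⟩
    exact ⟨x, ⟨by linarith, by push_cast; linarith⟩, rfl⟩

theorem mem_edgeSegment_verEdge {a b : ℤ} {x : ℝ × ℝ} :
    x ∈ edgeSegment (verEdge a b) ↔
      (b : ℝ) - 1 / 2 ≤ x.2 ∧ x.2 ≤ b + 1 / 2 ∧ x.1 = a - 1 / 2 := by
  obtain ⟨x, y⟩ := x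
  simp only [edgeSegment, verEdge, Sym2.lift_mk, Vertex.point]
  rw [← Prod.image_mk_segment_right, segment_eq_Icc (by push_cast; linarith)]
  constructor
  · rintro ⟨z, ⟨hz, hz'⟩, h⟩
    obtain ⟨rfl, rfl⟩ := Prod.mk.inj h
    push_cast at hz'
    exact ⟨by linarith, by linarith, rfl⟩
  · rintro ⟨h1, h2, rfl⟩
    exact ⟨y, ⟨by linarith, by push_cast; linarith⟩, rfl⟩

theorem mem_openEdge_horEdge {a b : ℤ} {x : ℝ × ℝ} :
    x ∈ openEdge (horEdge a b) ↔
      (a : ℝ) - 1 / 2 < x.1 ∧ x.1 < a + 1 / 2 ∧ x.2 = b - 1 / 2 := by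
  obtain ⟨x, y⟩ := x
  simp only [openEdge, horEdge, Sym2.lift_mk, Vertex.point]
  rw [← Prod.image_mk_openSegment_left, openSegment_eq_Ioo (by push_cast; linarith)]
  constructor
  · rintro ⟨z, ⟨hz, hz'⟩, h⟩
    obtain ⟨rfl, rfl⟩ := Prod.mk.inj h
    push_cast at hz'
    exact ⟨by linarith, by linarith, rfl⟩
  · rintro ⟨h1, h2, rfl⟩
    exact ⟨x, ⟨by linarith, by push_cast; linarith⟩, rfl⟩

theorem mem_openEdge_verEdge {a b : ℤ} {x : ℝ × ℝ} :
    x ∈ openEdge (verEdge a b) ↔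
      (b : ℝ) - 1 / 2 < x.2 ∧ x.2 < b + 1 / 2 ∧ x.1 = a - 1 / 2 := by
  obtain ⟨x, y⟩ := x
  simp only [openEdge, verEdge, Sym2.lift_mk, Vertex.point]
  rw [← Prod.image_mk_openSegment_right, openSegment_eq_Ioo (by push_cast; linarith)]
  constructor
  · rintro ⟨z, ⟨hz, hz'⟩, h⟩
    obtain ⟨rfl, rfl⟩ := Prod.mk.inj h
    push_cast at hz'
    exact ⟨by linarith, by linarith, rfl⟩
  · rintro ⟨h1, h2, rfl⟩
    exact ⟨y, ⟨by linarith, by push_cast; linarith⟩, rfl⟩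

theorem mem_openSquare {s : Square} {x : ℝ × ℝ} :
    x ∈ openSquare s ↔ ((s.1 : ℝ) - 1 / 2 < x.1 ∧ x.1 < s.1 + 1 / 2) ∧
      (s.2 : ℝ) - 1 / 2 < x.2 ∧ x.2 < s.2 + 1 / 2 := by
  simp [openSquare, Set.mem_prod]

/-- The closed unit square with centre `(i, j)`, as a region of the plane. -/
def closedSquare (s : Square) : Set (ℝ × ℝ) :=
  Set.Icc ((s.1 : ℝ) - 1 / 2) ((s.1 : ℝ) + 1 / 2) ×ˢ
    Set.Icc ((s.2 : ℝ) - 1 / 2) ((s.2 : ℝ) + 1 / 2)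

theorem mem_closedSquare {s : Square} {x : ℝ × ℝ} :
    x ∈ closedSquare s ↔ ((s.1 : ℝ) - 1 / 2 ≤ x.1 ∧ x.1 ≤ s.1 + 1 / 2) ∧
      (s.2 : ℝ) - 1 / 2 ≤ x.2 ∧ x.2 ≤ s.2 + 1 / 2 :=
  Iff.rfl

theorem isClosed_closedSquare (s : Square) : IsClosed (closedSquare s) :=
  isClosed_Icc.prod isClosed_Icc

theorem openSquare_subset_closedSquare (s : Square) : openSquare s ⊆ closedSquare s :=
  Set.prod_mono Set.Ioo_subset_Icc_self Set.Ioo_subset_Icc_self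

theorem closure_openSquare (s : Square) : closure (openSquare s) = closedSquare s := by
  rw [openSquare, closure_prod_eq, closure_Ioo (by linarith), closure_Ioo (by linarith),
    closedSquare]

theorem isPreconnected_openSquare (s : Square) : IsPreconnected (openSquare s) :=
  isPreconnected_Ioo.prod isPreconnected_Ioo

theorem center_mem_openSquare (s : Square) : ((s.1 : ℝ), (s.2 : ℝ)) ∈ openSquare s := by
  rw [mem_openSquare]
  constructor <;> constructor <;> simp only <;> linarith

theorem openEdge_nonempty {e : Sym2 Vertex} (he : IsGridEdge e) : (openEdge e).Nonempty := by
  obtain ⟨a, b, rfl | rfl⟩ := he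
  · exact ⟨((a : ℝ), b - 1 / 2), mem_openEdge_horEdge.2 ⟨by simp, by simp, rfl⟩⟩
  · exact ⟨((a : ℝ) - 1 / 2, (b : ℝ)), mem_openEdge_verEdge.2 ⟨by simp, by simp, rfl⟩⟩

theorem openEdge_subset_closedSquare {s : Square} {e : Sym2 Vertex} (he : e ∈ squareEdges s) :
    openEdge e ⊆ closedSquare s := by
  intro x hx
  rw [mem_closedSquare]
  rcases mem_squareEdges.1 he with rfl | rfl | rfl | rfl
  · have := mem_openEdge_horEdge.1 hx
    refine ⟨⟨?_, ?_⟩, ?_, ?_⟩ <;> linarith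
  · have := mem_openEdge_horEdge.1 hx
    push_cast at this
    refine ⟨⟨?_, ?_⟩, ?_, ?_⟩ <;> linarith
  · have := mem_openEdge_verEdge.1 hx
    refine ⟨⟨?_, ?_⟩, ?_, ?_⟩ <;> linarith
  · have := mem_openEdge_verEdge.1 hx
    push_cast at this
    refine ⟨⟨?_, ?_⟩, ?_, ?_⟩ <;> linarith

theorem int_ne_of_mem_Ioo {a b : ℤ} {x : ℝ} (h1 : (a : ℝ) - 1 / 2 < x) (h2 : x < a + 1 / 2) :
    x ≠ b - 1 / 2 := by
  rintro rfl
  have h3 : (a : ℝ) < b := by linarith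
  have h4 : (b : ℝ) < (a + 1 : ℤ) := by push_cast; linarith
  have := Int.cast_lt.1 h3
  have := Int.cast_lt.1 h4
  omega

theorem int_eq_of_mem_Ioo_of_mem_Icc {a b : ℤ} {x : ℝ} (h1 : (a : ℝ) - 1 / 2 < x)
    (h2 : x < a + 1 / 2) (h3 : (b : ℝ) - 1 / 2 ≤ x) (h4 : x ≤ b + 1 / 2) : b = a := by
  have h5 : (a : ℝ) < (b + 1 : ℤ) := by push_cast; linarith
  have h6 : (b : ℝ) < (a + 1 : ℤ) := by push_cast; linarith
  have := Int.cast_lt.1 h5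
  have := Int.cast_lt.1 h6
  omega

theorem notMem_trace_of_mem_openSquare {C : Set (Sym2 Vertex)} (hC : ∀ e ∈ C, IsGridEdge e)
    {s : Square} {x : ℝ × ℝ} (hx : x ∈ openSquare s) : x ∉ trace C := by
  simp only [trace, Set.mem_iUnion, not_exists]
  intro e he hxe
  rw [mem_openSquare] at hx
  obtain ⟨a, b, rfl | rfl⟩ := hC e he
  · exact int_ne_of_mem_Ioo hx.2.1 hx.2.2 (mem_edgeSegment_horEdge.1 hxe).2.2
  · exact int_ne_of_mem_Ioo hx.1.1 hx.1.2 (mem_edgeSegment_verEdge.1 hxe).2.2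

theorem notMem_trace_of_mem_openEdge {C : Set (Sym2 Vertex)} (hC : ∀ e ∈ C, IsGridEdge e)
    {e : Sym2 Vertex} (he : IsGridEdge e) (heC : e ∉ C) {x : ℝ × ℝ} (hx : x ∈ openEdge e) :
    x ∉ trace C := by
  simp only [trace, Set.mem_iUnion, not_exists]
  intro e' he' hxe
  obtain ⟨a, b, rfl | rfl⟩ := he <;> obtain ⟨c, d, rfl | rfl⟩ := hC e' he'
  · rw [mem_openEdge_horEdge] at hx
    rw [mem_edgeSegment_horEdge] at hxe
    have h1 := int_eq_of_mem_Ioo_of_mem_Icc hx.1 hx.2.1 hxe.1 hxe.2.1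
    have h2 : d = b := by exact_mod_cast (by linarith : (d : ℝ) = b)
    exact heC (h1 ▸ h2 ▸ he')
  · rw [mem_openEdge_horEdge] at hx
    exact int_ne_of_mem_Ioo hx.1 hx.2.1 (mem_edgeSegment_verEdge.1 hxe).2.2
  · rw [mem_openEdge_verEdge] at hx
    exact int_ne_of_mem_Ioo hx.1 hx.2.1 (mem_edgeSegment_horEdge.1 hxe).2.2
  · rw [mem_openEdge_verEdge] at hx
    rw [mem_edgeSegment_verEdge] at hxe
    have h1 := int_eq_of_mem_Ioo_of_mem_Icc hx.1 hx.2.1 hxe.1 hxe.2.1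
    have h2 : c = a := by exact_mod_cast (by linarith : (c : ℝ) = a)
    exact heC (h1 ▸ h2 ▸ he')

/-- A square and an edge of it that is not in `C` lie in one component of the complement. -/
theorem subset_connectedComponentIn {C : Set (Sym2 Vertex)} (hC : ∀ e ∈ C, IsGridEdge e)
    {s : Square} {e : Sym2 Vertex} (hes : e ∈ squareEdges s) (heC : e ∉ C)
    {x : ℝ × ℝ} (hx : x ∈ openSquare s ∪ openEdge e) :
    openSquare s ∪ openEdge e ⊆ connectedComponentIn (trace C)ᶜ x := by
  refine IsPreconnected.subset_connectedComponentIn ?_ hx ?_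
  -- The union lies between the connected open square and its closure, so it is connected.
  · refine (isPreconnected_openSquare s).subset_closure Set.subset_union_left ?_
    rw [closure_openSquare]
    exact Set.union_subset (openSquare_subset_closedSquare s) (openEdge_subset_closedSquare hes)
  · rintro y (hy | hy)
    · exact notMem_trace_of_mem_openSquare hC hy
    · exact notMem_trace_of_mem_openEdge hC (.of_mem_squareEdges hes) heC hy

theorem openSquare_subset_connectedComponentIn {C : Set (Sym2 Vertex)}
    (hC : ∀ e ∈ C, IsGridEdge e) {s : Square} {x : ℝ × ℝ} (hx : x ∈ openSquare s) :
    openSquare s ⊆ connectedComponentIn (trace C)ᶜ x :=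
  (isPreconnected_openSquare s).subset_connectedComponentIn hx
    fun _ hy => notMem_trace_of_mem_openSquare hC hy

theorem openSquare_subset_of_plusAdj {C : Set (Sym2 Vertex)} (hC : ∀ e ∈ C, IsGridEdge e)
    {s t : Square} {e : Sym2 Vertex} (hes : e ∈ squareEdges s) (het : e ∈ squareEdges t)
    (heC : e ∉ C) {x : ℝ × ℝ} (hx : openSquare s ⊆ connectedComponentIn (trace C)ᶜ x) :
    openSquare t ⊆ connectedComponentIn (trace C)ᶜ x := by
  obtain ⟨y, hy⟩ := openEdge_nonempty (.of_mem_squareEdges hes)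
  have hs := subset_connectedComponentIn hC hes heC (.inr hy)
  have ht := subset_connectedComponentIn hC het heC (.inr hy)
  have h1 := connectedComponentIn_eq (hx (center_mem_openSquare s))
  have h2 := connectedComponentIn_eq (hs (.inl (center_mem_openSquare s)))
  rw [h1, ← h2]
  exact Set.subset_union_left.trans ht

theorem disjoint_interiorOf_exteriorOf (C : Set (Sym2 Vertex)) :
    Disjoint (interiorOf C) (exteriorOf C) :=
  Set.disjoint_left.2 fun _ hi he => he.2 hi.2

/-- Needed for the region covered by the complement of a finite set: an infinite union of closed
squares is closed because the family is locally finite. -/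
theorem locallyFinite_closedSquare : LocallyFinite closedSquare := by
  intro x
  refine ⟨Metric.ball x 1, Metric.ball_mem_nhds x one_pos, ?_⟩
  refine ((Set.finite_Icc ⌊x.1 - 2⌋ ⌈x.1 + 2⌉).prod
    (Set.finite_Icc ⌊x.2 - 2⌋ ⌈x.2 + 2⌉)).subset ?_
  rintro s ⟨y, hys, hyx⟩
  rw [mem_closedSquare] at hys
  rw [Metric.mem_ball, Prod.dist_eq, max_lt_iff, Real.dist_eq, Real.dist_eq, abs_lt, abs_lt] at hyx
  have h1 := Int.floor_le (x.1 - 2)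
  have h2 := Int.le_ceil (x.1 + 2)
  have h3 := Int.floor_le (x.2 - 2)
  have h4 := Int.le_ceil (x.2 + 2)
  simp only [Set.mem_prod, Set.mem_Icc]
  refine ⟨⟨?_, ?_⟩, ?_, ?_⟩ <;> refine (Int.cast_le (R := ℝ)).1 ?_ <;> linarith

theorem exists_mem_closedSquare (x : ℝ × ℝ) : ∃ s, x ∈ closedSquare s := by
  refine ⟨(round x.1, round x.2), ?_⟩
  have h1 := abs_le.1 (abs_sub_round x.1)
  have h2 := abs_le.1 (abs_sub_round x.2)
  rw [mem_closedSquare]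
  refine ⟨⟨?_, ?_⟩, ?_, ?_⟩ <;> simp only <;> linarith

/-- The region covered by a set of closed squares. -/
def region (D : Set Square) : Set (ℝ × ℝ) := ⋃ s ∈ D, closedSquare s

theorem isClosed_region (D : Set Square) : IsClosed (region D) := by
  rw [region, Set.biUnion_eq_iUnion]
  exact (locallyFinite_closedSquare.comp_injective Subtype.val_injective).isClosed_iUnion
    fun s => isClosed_closedSquare s

theorem isBounded_region {D : Set Square} (hD : D.Finite) : Bornology.IsBounded (region D) :=
  (Bornology.isBounded_biUnion hD).2 fun _ _ =>
    (Metric.isBounded_Icc _ _).prod (Metric.isBounded_Icc _ _)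

theorem abs_sub_le_one {i k : ℤ} {x : ℝ} (h1 : (i : ℝ) - 1 / 2 ≤ x) (h2 : x ≤ i + 1 / 2)
    (h3 : (k : ℝ) - 1 / 2 ≤ x) (h4 : x ≤ k + 1 / 2) :
    i = k ∨ (i = k + 1 ∧ x = i - 1 / 2) ∨ (k = i + 1 ∧ x = k - 1 / 2) := by
  have h5 : i ≤ k + 1 := by
    have : (i : ℝ) ≤ (k + 1 : ℤ) := by push_cast; linarith
    exact_mod_cast this
  have h6 : k ≤ i + 1 := by
    have : (k : ℝ) ≤ (i + 1 : ℤ) := by push_cast; linarith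
    exact_mod_cast this
  obtain rfl | rfl | rfl : i = k ∨ i = k + 1 ∨ k = i + 1 := by omega
  · exact .inl rfl
  · refine .inr (.inl ⟨rfl, ?_⟩)
    push_cast at *
    linarith
  · refine .inr (.inr ⟨rfl, ?_⟩)
    push_cast at *
    linarith

theorem mem_trace_of_mem {C : Set (Sym2 Vertex)} {e : Sym2 Vertex} {x : ℝ × ℝ} (he : e ∈ C)
    (hx : x ∈ edgeSegment e) : x ∈ trace C :=
  Set.mem_biUnion he hx

theorem mem_trace_edgeBoundary_of_same_column {D : Set Square} {s t : Square} {x : ℝ × ℝ}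
    (hst : ¬ (s ∈ D ↔ t ∈ D)) (hxs : x ∈ closedSquare s) (hxt : x ∈ closedSquare t)
    (h : s.1 = t.1) : x ∈ trace (edgeBoundary D) := by
  obtain ⟨i, j⟩ := s
  obtain ⟨k, l⟩ := t
  obtain rfl : i = k := h
  rw [mem_closedSquare] at hxs hxt
  rcases abs_sub_le_one hxs.2.1 hxs.2.2 hxt.2.1 hxt.2.2 with h | ⟨h, hx⟩ | ⟨h, hx⟩
  · simp only at h
    subst h
    exact absurd Iff.rfl hst
  · simp only at h
    subst h
    refine mem_trace_of_mem (e := horEdge i (l + 1)) ?_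
      (mem_edgeSegment_horEdge.2 ⟨hxs.1.1, hxs.1.2, hx⟩)
    rw [horEdge_mem_edgeBoundary]
    simpa using hst
  · simp only at h
    subst h
    refine mem_trace_of_mem (e := horEdge i (j + 1)) ?_
      (mem_edgeSegment_horEdge.2 ⟨hxs.1.1, hxs.1.2, hx⟩)
    rw [horEdge_mem_edgeBoundary]
    simpa [iff_comm] using hst

theorem mem_trace_edgeBoundary_of_same_row {D : Set Square} {s t : Square} {x : ℝ × ℝ}
    (hst : ¬ (s ∈ D ↔ t ∈ D)) (hxs : x ∈ closedSquare s) (hxt : x ∈ closedSquare t)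
    (h : s.2 = t.2) : x ∈ trace (edgeBoundary D) := by
  obtain ⟨i, j⟩ := s
  obtain ⟨k, l⟩ := t
  obtain rfl : j = l := h
  rw [mem_closedSquare] at hxs hxt
  rcases abs_sub_le_one hxs.1.1 hxs.1.2 hxt.1.1 hxt.1.2 with h | ⟨h, hx⟩ | ⟨h, hx⟩
  · simp only at h
    subst h
    exact absurd Iff.rfl hst
  · simp only at h
    subst h
    refine mem_trace_of_mem (e := verEdge (k + 1) j) ?_
      (mem_edgeSegment_verEdge.2 ⟨hxs.2.1, hxs.2.2, hx⟩)
    rw [verEdge_mem_edgeBoundary]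
    simpa using hst
  · simp only at h
    subst h
    refine mem_trace_of_mem (e := verEdge (i + 1) j) ?_
      (mem_edgeSegment_verEdge.2 ⟨hxs.2.1, hxs.2.2, hx⟩)
    rw [verEdge_mem_edgeBoundary]
    simpa [iff_comm] using hst

theorem region_inter_region_compl_subset (D : Set Square) :
    region D ∩ region Dᶜ ⊆ trace (edgeBoundary D) := by
  rintro x ⟨hxD, hxD'⟩
  simp only [region, Set.mem_iUnion] at hxD hxD'
  obtain ⟨s, hs, hxs⟩ := hxD
  obtain ⟨t, ht, hxt⟩ := hxD'
  -- `s` and `t` may touch only at a corner. The square in the column of `s` and the row of `t` also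
  -- contains `x`, and membership in `D` changes on one of the two moves through it.
  have hu : x ∈ closedSquare (s.1, t.2) := by
    rw [mem_closedSquare] at *
    exact ⟨hxs.1, hxt.2⟩
  by_cases hsu : s ∈ D ↔ ((s.1, t.2) : Square) ∈ D
  · refine mem_trace_edgeBoundary_of_same_row (s := (s.1, t.2)) (t := t) ?_ hu hxt rfl
    rw [← hsu]
    exact fun h => ht (h.1 hs)
  · exact mem_trace_edgeBoundary_of_same_column hsu hxs hu rfl

/-- The component of a point of the square cannot leave the bounded set `region D`: otherwise, being
connected, it would meet both closed regions at a common point, which lies on the curve. -/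
theorem openSquare_subset_interiorOf_edgeBoundary {D : Set Square} (hD : D.Finite) {s : Square}
    (hs : s ∈ D) : openSquare s ⊆ interiorOf (edgeBoundary D) := by
  intro x hx
  have hxt : x ∉ trace (edgeBoundary D) :=
    notMem_trace_of_mem_openSquare (fun _ => .of_mem_edgeBoundary) hx
  refine ⟨hxt, (isBounded_region hD).subset fun y hy => ?_⟩
  by_contra hyD
  have hcover : ∀ z, z ∈ region D ∪ region Dᶜ := by
    intro z
    obtain ⟨t, ht⟩ := exists_mem_closedSquare z
    by_cases htD : t ∈ D
    · exact .inl (Set.mem_biUnion htD ht)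
    · exact .inr (Set.mem_biUnion (s := Dᶜ) htD ht)
  obtain ⟨z, hz, hz'⟩ := isPreconnected_closed_iff.1
    (isPreconnected_connectedComponentIn (x := x) (F := (trace (edgeBoundary D))ᶜ))
    _ _ (isClosed_region D) (isClosed_region Dᶜ) (fun z _ => hcover z)
    ⟨x, mem_connectedComponentIn hxt, Set.mem_biUnion hs (openSquare_subset_closedSquare s hx)⟩
    ⟨y, hy, (hcover y).resolve_left hyD⟩
  exact connectedComponentIn_subset _ _ hz (region_inter_region_compl_subset D hz')

/-- Enlarging the curve only shrinks the components of the complement. -/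
theorem interiorOf_subset_of_subset {C C' : Set (Sym2 Vertex)} (h : C ⊆ C') {x : ℝ × ℝ}
    (hx : x ∈ interiorOf C) : x ∉ exteriorOf C' := fun hx' =>
  hx'.2 (hx.2.subset (connectedComponentIn_mono _
    (Set.compl_subset_compl.2 (Set.biUnion_subset_biUnion_left h))))

/-! ### Cycles in finite graphs without leaves -/

-- In a forest without leaves every path can be prolonged at its start: the new neighbour is not
-- already on the path, as that would force the new edge to be the first edge. Arbitrarily long
-- paths contradict finiteness.
open Classical in
theorem not_isAcyclic_of_finite_of_no_leaf {V : Type*} {H : SimpleGraph V}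
    (hfin : H.support.Finite) (hne : H.edgeSet.Nonempty)
    (h : ∀ e ∈ H.edgeSet, ∀ u ∈ e, ∃ e' ∈ H.edgeSet, e' ≠ e ∧ u ∈ e') : ¬ H.IsAcyclic := by
  intro hH
  have hpath : ∀ n : ℕ, ∃ (u v : V) (p : H.Walk u v), p.IsPath ∧ p.length = n + 1 := by
    intro n
    induction n with
    | zero =>
      obtain ⟨e, he⟩ := hne
      induction e with
      | _ u v =>
        rw [SimpleGraph.mem_edgeSet] at he
        exact ⟨u, v, he.toWalk, by simpa using he.ne, rfl⟩
    | succ n ih =>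
      obtain ⟨u, v, p, hp, hlen⟩ := ih
      have hnil : ¬ p.Nil := by
        rw [← SimpleGraph.Walk.length_eq_zero_iff]
        omega
      obtain ⟨e', he', hne', hu⟩ := h s(u, p.snd) (p.adj_snd hnil) u (Sym2.mem_mk_left _ _)
      obtain ⟨w, rfl⟩ := Sym2.mem_iff_exists.1 hu
      rw [SimpleGraph.mem_edgeSet] at he'
      have hw : w ∉ p.support := fun hw =>
        hne' (by rw [hH.eq_snd_of_adj_start hp he' hw])
      exact ⟨w, v, .cons he'.symm p, hp.cons hw, by simp [hlen]⟩
  obtain ⟨u, v, p, hp, hlen⟩ := hpath hfin.toFinset.card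
  have hsub : p.support.toFinset ⊆ hfin.toFinset := fun x hx => by
    rw [Set.Finite.mem_toFinset]
    refine SimpleGraph.mem_support_of_mem_walk_support p (fun hnil => ?_) (List.mem_toFinset.1 hx)
    rw [← SimpleGraph.Walk.length_eq_zero_iff] at hnil
    omega
  have := Finset.card_le_card hsub
  rw [List.toFinset_card_of_nodup hp.support_nodup, SimpleGraph.Walk.length_support] at this
  omega

/-! ### The two-colouring of the squares defined by a cycle -/

/-- A discrete Poincaré lemma: sum `h` up each column, starting from the level `N` below which
everything vanishes. The condition at each corner makes the horizontal differences equal to `v`, by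
induction on the height. -/
theorem exists_potential {h v : ℤ → ℤ → ZMod 2} {N : ℤ}
    (hh : ∀ a b, b ≤ N → h a b = 0) (hv : ∀ a b, b ≤ N → v a b = 0)
    (hvert : ∀ a b, h a b + h (a - 1) b + v a b + v a (b - 1) = 0) :
    ∃ c : Square → ZMod 2, (∀ a b, c (a, b) = c (a, b - 1) + h a b) ∧
      ∀ a b, c (a, b) = c (a - 1, b) + v a b := by
  have hstep : ∀ a b, ∑ k ∈ Finset.Ioc N b, h a k =
      (∑ k ∈ Finset.Ioc N (b - 1), h a k) + h a b := by
    intro a b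
    rcases le_or_gt b N with hb | hb
    · rw [hh a b hb, Finset.Ioc_eq_empty (by omega), Finset.Ioc_eq_empty (by omega)]
      simp
    · have : Finset.Ioc N b = insert b (Finset.Ioc N (b - 1)) := by
        ext k
        simp only [Finset.mem_Ioc, Finset.mem_insert]
        omega
      rw [this, Finset.sum_insert (by simp), add_comm]
  refine ⟨fun s => ∑ k ∈ Finset.Ioc N s.2, h s.1 k, hstep, fun a b => ?_⟩
  rcases le_or_gt b N with hb | hb
  · simp [hv a b hb, Finset.Ioc_eq_empty (show ¬ N < b by omega)]
  · simp only
    induction b, hb.le using Int.leInduction with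
    | base => simp [hv a N le_rfl]
    | succ b hb' ih =>
      rw [hstep a, hstep (a - 1), add_sub_cancel_right]
      have ih' : ∑ k ∈ Finset.Ioc N b, h a k = ∑ k ∈ Finset.Ioc N b, h (a - 1) k + v a b := by
        rcases hb'.eq_or_lt with rfl | hb'
        · simp [hv a N le_rfl]
        · exact ih hb'
      have := hvert a (b + 1)
      rw [add_sub_cancel_right] at this
      have h2 : ∀ x : ZMod 2, x + x = 0 := CharTwo.add_self_eq_zero
      rw [ih']
      linear_combination this - h2 (h (a - 1) (b + 1)) - h2 (v a (b + 1))

theorem mem_horEdge {x : Vertex} {a b : ℤ} :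
    x ∈ horEdge a b ↔ x = (a, b) ∨ x = (a + 1, b) := Sym2.mem_iff

theorem mem_verEdge {x : Vertex} {a b : ℤ} :
    x ∈ verEdge a b ↔ x = (a, b) ∨ x = (a, b + 1) := Sym2.mem_iff

/-- The four edges of the lattice at a corner. -/
def starEdges (x : Vertex) : Finset (Sym2 Vertex) :=
  {horEdge x.1 x.2, horEdge (x.1 - 1) x.2, verEdge x.1 x.2, verEdge x.1 (x.2 - 1)}

theorem IsGridEdge.mem_starEdges {e : Sym2 Vertex} (he : IsGridEdge e) {x : Vertex} :
    e ∈ starEdges x ↔ x ∈ e := by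
  obtain ⟨i, j⟩ := x
  obtain ⟨a, b, rfl | rfl⟩ := he
  · simp only [starEdges, Finset.mem_insert, Finset.mem_singleton, horEdge_inj,
      horEdge_ne_verEdge, mem_horEdge, Prod.mk.injEq, or_false]
    omega
  · simp only [starEdges, Finset.mem_insert, Finset.mem_singleton, verEdge_inj,
      verEdge_ne_horEdge, mem_verEdge, Prod.mk.injEq, false_or]
    omega

theorem isGridEdge_of_mem_starEdges {e : Sym2 Vertex} {x : Vertex} (he : e ∈ starEdges x) :
    IsGridEdge e := by
  simp only [starEdges, Finset.mem_insert, Finset.mem_singleton] at he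
  rcases he with h | h | h | h
  exacts [⟨_, _, .inl h⟩, ⟨_, _, .inl h⟩, ⟨_, _, .inr h⟩, ⟨_, _, .inr h⟩]

-- A closed trail uses an even number of edges at each vertex.
open Classical in
theorem sum_starEdges_eq_zero {G : SimpleGraph Vertex} {C : Set (Sym2 Vertex)}
    (hC : IsCycleIn G C) (hgrid : ∀ e ∈ C, IsGridEdge e) (x : Vertex) :
    ∑ e ∈ starEdges x, (if e ∈ C then 1 else 0 : ZMod 2) = 0 := by
  obtain ⟨v, p, hp, hCp⟩ := hC
  have hmem : ∀ e, e ∈ C ↔ e ∈ p.edges := fun e => by rw [hCp]; rfl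
  have heven := (hp.isCircuit.isTrail.even_countP_edges_iff x).2 fun h => absurd rfl h
  rw [← ZMod.natCast_eq_zero_iff_even] at heven
  refine Eq.trans ?_ heven
  rw [Finset.sum_boole (R := ZMod 2), List.countP_eq_length_filter,
    ← List.toFinset_card_of_nodup (hp.isCircuit.isTrail.edges_nodup.filter _)]
  congr 2
  ext e
  simp only [Finset.mem_filter, List.mem_toFinset, List.mem_filter, hmem, decide_eq_true_eq]
  constructor
  · exact fun h => ⟨h.2, (hgrid e ((hmem e).2 h.2)).mem_starEdges.1 h.1⟩
  · exact fun h => ⟨(hgrid e ((hmem e).2 h.1)).mem_starEdges.2 h.2, h.1⟩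

-- The colouring is the mod 2 potential of the indicator of `C`; the condition at corners is the
-- even degree of a cycle.
open Classical in
theorem exists_coloring_of_isCycleIn {G : SimpleGraph Vertex} {C : Set (Sym2 Vertex)}
    (hC : IsCycleIn G C) (hgrid : ∀ e ∈ C, IsGridEdge e) :
    ∃ c : Square → ZMod 2, ∀ s t e, s ≠ t → e ∈ squareEdges s → e ∈ squareEdges t →
      (c s = c t ↔ e ∉ C) := by
  have hfin : C.Finite := by
    obtain ⟨v, p, -, rfl⟩ := hC
    exact p.edges.finite_toSet
  -- A level at or below which `C` has no edges, where the potential starts from zero.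
  have hbdd : ∃ N : ℤ, ∀ e ∈ C, ∀ a b, e = horEdge a b ∨ e = verEdge a b → N < b := by
    have h1 := hfin.preimage (f := fun q : ℤ × ℤ => horEdge q.1 q.2)
      (fun q _ q' _ h => by simpa [Prod.ext_iff] using h)
    have h2 := hfin.preimage (f := fun q : ℤ × ℤ => verEdge q.1 q.2)
      (fun q _ q' _ h => by simpa [Prod.ext_iff] using h)
    obtain ⟨N, hN⟩ := ((h1.union h2).image Prod.snd).bddBelow
    refine ⟨N - 1, ?_⟩
    rintro e he a b (rfl | rfl)
    · have := hN ⟨(a, b), .inl he, rfl⟩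
      simp only at this
      omega
    · have := hN ⟨(a, b), .inr he, rfl⟩
      simp only at this
      omega
  obtain ⟨N, hN⟩ := hbdd
  let f : Sym2 Vertex → ZMod 2 := fun e => if e ∈ C then 1 else 0
  obtain ⟨c, hc1, hc2⟩ := exists_potential (h := fun a b => f (horEdge a b))
    (v := fun a b => f (verEdge a b)) (N := N)
    (fun a b hb => if_neg fun h => absurd (hN _ h a b (.inl rfl)) (by omega))
    (fun a b hb => if_neg fun h => absurd (hN _ h a b (.inr rfl)) (by omega))
    (fun a b => by
      have := sum_starEdges_eq_zero hC hgrid (a, b)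
      have ha : a ≠ a - 1 := by omega
      have hb : b ≠ b - 1 := by omega
      rw [starEdges, Finset.sum_insert (by simp [ha]), Finset.sum_insert (by simp),
        Finset.sum_insert (by simp [hb]), Finset.sum_singleton] at this
      simp only [f]
      linear_combination this)
  have key : ∀ s t e, c s = c t + f e → (c s = c t ↔ e ∉ C) := by
    intro s t e h
    rw [h, add_eq_left]
    by_cases he : e ∈ C <;> simp [f, he]
  refine ⟨c, fun s t e hst hs ht => ?_⟩
  obtain ⟨a, b, rfl | rfl⟩ := IsGridEdge.of_mem_squareEdges hs
  · rw [horEdge_mem_squareEdges] at hs ht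
    rcases hs with rfl | rfl <;> rcases ht with rfl | rfl
    · exact absurd rfl hst
    · exact key _ _ _ (hc1 a b)
    · rw [eq_comm]
      exact key _ _ _ (hc1 a b)
    · exact absurd rfl hst
  · rw [verEdge_mem_squareEdges] at hs ht
    rcases hs with rfl | rfl <;> rcases ht with rfl | rfl
    · exact absurd rfl hst
    · exact key _ _ _ (hc2 a b)
    · rw [eq_comm]
      exact key _ _ _ (hc2 a b)
    · exact absurd rfl hst

/-! ### The edge boundary of a connected set with connected complement -/

theorem IsCycleIn.nonempty {G : SimpleGraph Vertex} {C : Set (Sym2 Vertex)}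
    (hC : IsCycleIn G C) : C.Nonempty := by
  obtain ⟨v, p, hp, rfl⟩ := hC
  obtain ⟨e, he⟩ := List.exists_mem_of_ne_nil p.edges
    fun h => hp.ne_nil (SimpleGraph.Walk.edges_eq_nil.1 h).eq_nil
  exact ⟨e, he⟩

theorem IsCycleIn.mono {G G' : SimpleGraph Vertex} (h : G ≤ G') {C : Set (Sym2 Vertex)}
    (hC : IsCycleIn G C) : IsCycleIn G' C := by
  obtain ⟨v, p, hp, rfl⟩ := hC
  exact ⟨v, p.mapLe h, hp.mapLe h, by simp⟩

theorem eq_of_reachable_occupiedGraph {D : Set Square} {α : Type*} {c : Square → α}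
    (hc : ∀ s ∈ D, ∀ t ∈ D, PlusAdj s t → c s = c t) {s t : Square}
    (h : (occupiedGraph D).Reachable s t) : c s = c t := by
  obtain ⟨p⟩ := h
  induction p with
  | nil => rfl
  | cons hadj _ ih => exact (hc _ hadj.1 _ hadj.2.1 hadj.2.2).trans ih

theorem eq_or_eq_of_mem_squareEdges {s t u : Square} {e : Sym2 Vertex} (hst : s ≠ t)
    (hs : e ∈ squareEdges s) (ht : e ∈ squareEdges t) (hu : e ∈ squareEdges u) :
    u = s ∨ u = t := by
  obtain ⟨a, b, rfl | rfl⟩ := IsGridEdge.of_mem_squareEdges hs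
  · rw [horEdge_mem_squareEdges] at hs ht hu
    grind
  · rw [verEdge_mem_squareEdges] at hs ht hu
    grind

theorem mem_edgeBoundary_iff_of_ne {D : Set Square} {s t : Square} {e : Sym2 Vertex}
    (hst : s ≠ t) (hs : e ∈ squareEdges s) (ht : e ∈ squareEdges t) :
    e ∈ edgeBoundary D ↔ ¬ (s ∈ D ↔ t ∈ D) := by
  constructor
  · rintro ⟨s', t', hs', ht', hes', het'⟩
    rcases eq_or_eq_of_mem_squareEdges hst hs ht hes' with rfl | rfl <;>
      rcases eq_or_eq_of_mem_squareEdges hst hs ht het' with rfl | rfl <;> tauto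
  · intro h
    by_cases hsD : s ∈ D
    · exact ⟨s, t, hsD, fun htD => h (iff_of_true hsD htD), hs, ht⟩
    · exact ⟨t, s, by tauto, hsD, ht, hs⟩

theorem edgeBoundary_nonempty {D : Set Square} (hfin : D.Finite) (hne : D.Nonempty) :
    (edgeBoundary D).Nonempty := by
  obtain ⟨⟨a, b⟩, hs, hmax⟩ := Set.exists_max_image D Prod.snd hfin hne
  -- The top edge of a highest square of `D`.
  refine ⟨horEdge a (b + 1), (a, b), (a, b + 1), hs, fun h => ?_, ?_, ?_⟩
  · have := hmax _ h
    simp at this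
  · simp [horEdge_mem_squareEdges]
  · simp [horEdge_mem_squareEdges]

/-- Going round the four squares at a corner, membership in `D` changes an even number of times, so
never exactly once. -/
theorem exists_ne_mem_edgeBoundary {D : Set Square} {e : Sym2 Vertex} (he : e ∈ edgeBoundary D)
    {x : Vertex} (hx : x ∈ e) : ∃ e' ∈ edgeBoundary D, e' ≠ e ∧ x ∈ e' := by
  by_contra! hcon
  obtain ⟨a, b⟩ := x
  have hstar : ∀ e' ∈ starEdges (a, b), e' ≠ e → e' ∉ edgeBoundary D := fun e' he' hne h =>
    hcon e' h hne ((isGridEdge_of_mem_starEdges he').mem_starEdges.1 he')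
  have hxe := (IsGridEdge.of_mem_edgeBoundary he).mem_starEdges.2 hx
  simp only [starEdges, Finset.mem_insert, Finset.mem_singleton, forall_eq_or_imp, forall_eq]
    at hstar hxe
  obtain ⟨h1, h2, h3, h4⟩ := hstar
  have e2 : a - 1 ≠ a := by omega
  have e3 : b - 1 ≠ b := by omega
  rcases hxe with rfl | rfl | rfl | rfl <;>
    simp [horEdge_mem_edgeBoundary, verEdge_mem_edgeBoundary, e2, e3, e2.symm, e3.symm]
      at h1 h2 h3 h4 he <;> tauto

theorem isCycleIn_edgeBoundary {D : Set Square} (hfin : D.Finite) (hne : D.Nonempty)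
    (hD : ∀ s ∈ D, ∀ t ∈ D, (occupiedGraph D).Reachable s t)
    (hD' : ∀ s ∉ D, ∀ t ∉ D, (occupiedGraph Dᶜ).Reachable s t) :
    IsCycleIn (SimpleGraph.fromEdgeSet (edgeBoundary D)) (edgeBoundary D) := by
  set H := SimpleGraph.fromEdgeSet (edgeBoundary D) with hH
  have hset : H.edgeSet = edgeBoundary D := by
    rw [hH, SimpleGraph.edgeSet_fromEdgeSet, sdiff_eq_left, Set.disjoint_left]
    exact fun e he hd => not_isDiag_of_isGridEdge (.of_mem_edgeBoundary he) hd
  have hsupp : H.support.Finite := by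
    have hE : (edgeBoundary D).Finite := by
      refine (hfin.biUnion (t := squareEdges) fun s _ => by simp [squareEdges]).subset ?_
      rintro e ⟨s, t, hs, -, he, -⟩
      exact Set.mem_biUnion hs he
    refine (hE.biUnion (t := fun e => {x | x ∈ e}) fun e _ => ?_).subset ?_
    · induction e with
      | _ u v => exact (Set.toFinite {u, v}).subset fun x hx => by simpa using hx
    · rintro x ⟨y, hxy⟩
      exact Set.mem_biUnion (hset ▸ hxy : s(x, y) ∈ edgeBoundary D) (Sym2.mem_mk_left x y)
  have hcyc : ¬ H.IsAcyclic := by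
    refine not_isAcyclic_of_finite_of_no_leaf hsupp ?_ ?_ <;> rw [hset]
    · exact edgeBoundary_nonempty hfin hne
    · exact fun e he x hx => exists_ne_mem_edgeBoundary he hx
  simp only [SimpleGraph.IsAcyclic, not_forall, not_not] at hcyc
  obtain ⟨v, p, hp⟩ := hcyc
  have hC : IsCycleIn H {e | e ∈ p.edges} := ⟨v, p, hp, rfl⟩
  generalize {e | e ∈ p.edges} = C at hC
  have hCB : C ⊆ edgeBoundary D := hset ▸ hC.subset_edgeSet
  obtain ⟨c, hc⟩ := exists_coloring_of_isCycleIn hC fun e he => .of_mem_edgeBoundary (hCB he)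
  have hin : ∀ s ∈ D, ∀ t ∈ D, c s = c t := fun s hs t ht =>
    eq_of_reachable_occupiedGraph (fun s hs t ht hst => by
      obtain ⟨hst, e, hes, het⟩ := hst
      exact (hc s t e hst hes het).2 fun heC =>
        (mem_edgeBoundary_iff_of_ne hst hes het).1 (hCB heC) (iff_of_true hs ht)) (hD s hs t ht)
  have hout : ∀ s ∉ D, ∀ t ∉ D, c s = c t := fun s hs t ht =>
    eq_of_reachable_occupiedGraph (fun s hs t ht hst => by
      obtain ⟨hst, e, hes, het⟩ := hst
      exact (hc s t e hst hes het).2 fun heC =>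
        (mem_edgeBoundary_iff_of_ne hst hes het).1 (hCB heC) (iff_of_false hs ht)) (hD' s hs t ht)
  suffices edgeBoundary D ⊆ C by rwa [← hCB.antisymm this]
  obtain ⟨e₀, he₀⟩ := hC.nonempty
  obtain ⟨s₀, t₀, hs₀, ht₀, hes₀, het₀⟩ := hCB he₀
  rintro e ⟨s, t, hs, ht, hes, het⟩
  by_contra heC
  have h1 := (hc s t e (fun h => ht (h ▸ hs)) hes het).2 heC
  rw [hin s hs s₀ hs₀, hout t ht t₀ ht₀] at h1
  exact (hc s₀ t₀ e₀ (fun h => ht₀ (h ▸ hs₀)) hes₀ het₀).1 h1 he₀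

/-! ### The part of the complement of a finite set that is connected to infinity -/

theorem occupiedGraph_mono {X Y : Set Square} (h : X ⊆ Y) : occupiedGraph X ≤ occupiedGraph Y :=
  fun _ _ hst => ⟨h hst.1, h hst.2.1, hst.2.2⟩

theorem reachable_row {X : Set Square} {a b j : ℤ} (hab : a ≤ b)
    (h : ∀ i, a ≤ i → i ≤ b → (i, j) ∈ X) : (occupiedGraph X).Reachable (a, j) (b, j) := by
  induction b, hab using Int.leInduction with
  | base => rfl
  | succ b hb ih =>
    refine (ih fun i h1 h2 => h i h1 (by omega)).trans (SimpleGraph.Adj.reachable ?_)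
    exact ⟨h b hb (by omega), h (b + 1) (by omega) le_rfl, plusAdj_iff.2 (by simp)⟩

theorem reachable_column {X : Set Square} {a b i : ℤ} (hab : a ≤ b)
    (h : ∀ j, a ≤ j → j ≤ b → (i, j) ∈ X) : (occupiedGraph X).Reachable (i, a) (i, b) := by
  induction b, hab using Int.leInduction with
  | base => rfl
  | succ b hb ih =>
    refine (ih fun j h1 h2 => h j h1 (by omega)).trans (SimpleGraph.Adj.reachable ?_)
    exact ⟨h b hb (by omega), h (b + 1) (by omega) le_rfl, plusAdj_iff.2 (by simp)⟩

/-- Every square on a walk to `q` is itself connected to `q`, so the walk stays in the component.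
This serves both `outside K N` and the component of the origin. -/
theorem reachable_occupiedGraph_component {X : Set Square} {s q : Square}
    (h : (occupiedGraph X).Reachable s q) :
    (occupiedGraph {t | t ∈ X ∧ (occupiedGraph X).Reachable t q}).Reachable s q := by
  obtain ⟨p⟩ := h
  induction p with
  | nil => rfl
  | cons hadj p ih =>
    refine SimpleGraph.Reachable.trans (SimpleGraph.Adj.reachable ?_) ih
    exact ⟨⟨hadj.1, hadj.reachable.trans ⟨p⟩⟩, ⟨hadj.2.1, ⟨p⟩⟩, hadj.2.2⟩

/-- All squares of `K` have coordinates of absolute value at most `N`. -/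
def InBox (K : Set Square) (N : ℤ) : Prop :=
  ∀ s ∈ K, (-N ≤ s.1 ∧ s.1 ≤ N) ∧ -N ≤ s.2 ∧ s.2 ≤ N

theorem exists_inBox {K : Set Square} (hK : K.Finite) : ∃ N, InBox K N := by
  obtain ⟨N, hN⟩ := (hK.image fun s => max |s.1| |s.2|).bddAbove
  refine ⟨N, fun s hs => ?_⟩
  have h := hN ⟨s, hs, rfl⟩
  simp only at h
  exact ⟨abs_le.1 ((le_max_left _ _).trans h), abs_le.1 ((le_max_right _ _).trans h)⟩

/-- The squares outside `K` that are connected outside `K` to the square `(N + 1, N + 1)`. -/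
def outside (K : Set Square) (N : ℤ) : Set Square :=
  {t | t ∈ Kᶜ ∧ (occupiedGraph Kᶜ).Reachable t (N + 1, N + 1)}

theorem InBox.notMem {K : Set Square} {N : ℤ} (hN : InBox K N) {s : Square}
    (hs : s.1 < -N ∨ N < s.1 ∨ s.2 < -N ∨ N < s.2) : s ∈ Kᶜ := fun h => by
  have := hN s h
  omega

theorem InBox.mem_outside {K : Set Square} {N : ℤ} (hN : InBox K N) {s : Square}
    (hs : s.1 < -N ∨ N < s.1 ∨ s.2 < -N ∨ N < s.2) : s ∈ outside K N := by
  refine ⟨hN.notMem hs, ?_⟩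
  obtain ⟨i, j⟩ := s
  have hrow : ∀ {j}, (j < -N ∨ N < j) → ∀ i k,
      (occupiedGraph Kᶜ).Reachable (i, j) (k, j) := by
    intro j hj i k
    have hmem : ∀ i, (i, j) ∈ Kᶜ := fun i => hN.notMem (by simp only; omega)
    rcases le_total i k with h | h
    · exact reachable_row h fun i _ _ => hmem i
    · exact (reachable_row h fun i _ _ => hmem i).symm
  have hcol : ∀ {i}, (i < -N ∨ N < i) → ∀ j k,
      (occupiedGraph Kᶜ).Reachable (i, j) (i, k) := by
    intro i hi j k
    have hmem : ∀ j, (i, j) ∈ Kᶜ := fun j => hN.notMem (by simp only; omega)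
    rcases le_total j k with h | h
    · exact reachable_column h fun i _ _ => hmem i
    · exact (reachable_column h fun i _ _ => hmem i).symm
  -- A column or row through the square misses the box. Follow it to the row or column with index `N
  -- + 1`, which misses the box too and leads to `(N + 1, N + 1)`.
  by_cases hi : i < -N ∨ N < i
  · exact (hcol hi j (N + 1)).trans (hrow (.inr (by omega)) i (N + 1))
  · have hj : j < -N ∨ N < j := by
      simp only at hs
      omega
    exact (hrow hj i (N + 1)).trans (hcol (.inr (by omega)) j (N + 1))

theorem mem_outside_of_plusAdj {K : Set Square} {N : ℤ} {s t : Square} (hs : s ∉ K)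
    (ht : t ∈ outside K N) (hst : PlusAdj s t) : s ∈ outside K N :=
  ⟨hs, (show (occupiedGraph Kᶜ).Adj s t from ⟨hs, ht.1, hst⟩).reachable.trans ht.2⟩

theorem subset_compl_outside (K : Set Square) (N : ℤ) : K ⊆ (outside K N)ᶜ :=
  fun _ hs h => h.1 hs

theorem InBox.finite_compl_outside {K : Set Square} {N : ℤ} (hN : InBox K N) :
    ((outside K N)ᶜ).Finite := by
  refine ((Set.finite_Icc (-N) N).prod (Set.finite_Icc (-N) N)).subset fun s hs => ?_
  by_contra h
  refine hs (hN.mem_outside ?_)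
  simp only [Set.mem_prod, Set.mem_Icc] at h
  omega

theorem reachable_outside {K : Set Square} {N : ℤ} {s t : Square} (hs : s ∈ outside K N)
    (ht : t ∈ outside K N) : (occupiedGraph (outside K N)).Reachable s t :=
  (reachable_occupiedGraph_component hs.2).trans (reachable_occupiedGraph_component ht.2).symm

/-- Walk to the right. A square off `K` and not in `outside K N` has no neighbour in `outside K N`,
so the walk stays in the complement; it must hit `K` before leaving the box. -/
theorem InBox.exists_reachable_of_mem_compl_outside {K : Set Square} {N : ℤ} (hN : InBox K N)
    {s : Square} (hs : s ∈ (outside K N)ᶜ) :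
    ∃ t ∈ K, (occupiedGraph (outside K N)ᶜ).Reachable s t := by
  obtain ⟨a, b⟩ := s
  -- `n` bounds the number of steps left before the walk leaves the box.
  have key : ∀ (n : ℕ) (a : ℤ), N < a + n → (a, b) ∈ (outside K N)ᶜ →
      ∃ t ∈ K, (occupiedGraph (outside K N)ᶜ).Reachable (a, b) t := by
    intro n
    induction n with
    | zero =>
      intro a ha hs
      exact absurd (hN.mem_outside (by simp only; omega)) hs
    | succ n ih =>
      intro a ha hs
      by_cases hK : (a, b) ∈ K
      · exact ⟨_, hK, .refl _⟩
      have hadj : PlusAdj (a, b) (a + 1, b) := plusAdj_iff.2 (by simp)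
      have hs' : (a + 1, b) ∈ (outside K N)ᶜ := fun h => hs (mem_outside_of_plusAdj hK h hadj)
      obtain ⟨t, ht, hr⟩ := ih (a + 1) (by push_cast at ha; omega) hs'
      have hadj' : (occupiedGraph (outside K N)ᶜ).Adj (a, b) (a + 1, b) := ⟨hs, hs', hadj⟩
      exact ⟨t, ht, hadj'.reachable.trans hr⟩
  exact key (N + 1 - a).toNat a (by omega) hs

theorem InBox.reachable_compl_outside {K : Set Square} {N : ℤ} (hN : InBox K N)
    (hK : ∀ s ∈ K, ∀ t ∈ K, (occupiedGraph K).Reachable s t) {s t : Square}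
    (hs : s ∈ (outside K N)ᶜ) (ht : t ∈ (outside K N)ᶜ) :
    (occupiedGraph (outside K N)ᶜ).Reachable s t := by
  obtain ⟨s', hs', hr⟩ := hN.exists_reachable_of_mem_compl_outside hs
  obtain ⟨t', ht', hr'⟩ := hN.exists_reachable_of_mem_compl_outside ht
  exact hr.trans (((hK s' hs' t' ht').mono
    (occupiedGraph_mono (subset_compl_outside K N))).trans hr'.symm)

/-! ### Exterior of curves along the edges of `K` -/

theorem IsCycleIn.isGridEdge {K : Set Square} {C : Set (Sym2 Vertex)}
    (hC : IsCycleIn (cornerGraph K) C) : ∀ e ∈ C, IsGridEdge e := fun e he => by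
  obtain ⟨s, -, hs⟩ := mem_edgeSet_cornerGraph.1 (hC.subset_edgeSet he)
  exact .of_mem_squareEdges hs

theorem mem_exteriorOf_of_mem_connectedComponentIn {C : Set (Sym2 Vertex)} {x y : ℝ × ℝ}
    (hx : x ∈ exteriorOf C) (hy : y ∈ connectedComponentIn (trace C)ᶜ x) : y ∈ exteriorOf C := by
  refine ⟨connectedComponentIn_subset _ _ hy, ?_⟩
  rw [← connectedComponentIn_eq hy]
  exact hx.2

theorem openEdge_subset_exteriorOf {C : Set (Sym2 Vertex)} (hC : ∀ e ∈ C, IsGridEdge e)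
    {s : Square} {e : Sym2 Vertex} (hes : e ∈ squareEdges s) (heC : e ∉ C)
    (hs : openSquare s ⊆ exteriorOf C) : openEdge e ⊆ exteriorOf C := fun _ hx =>
  mem_exteriorOf_of_mem_connectedComponentIn (hs (center_mem_openSquare s))
    (subset_connectedComponentIn hC hes heC (.inl (center_mem_openSquare s)) (.inr hx))

theorem openSquare_subset_exteriorOf_of_openEdge {C : Set (Sym2 Vertex)}
    (hC : ∀ e ∈ C, IsGridEdge e) {s : Square} {e : Sym2 Vertex} (hes : e ∈ squareEdges s)
    (heC : e ∉ C) (he : openEdge e ⊆ exteriorOf C) : openSquare s ⊆ exteriorOf C := by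
  obtain ⟨y, hy⟩ := openEdge_nonempty (.of_mem_squareEdges hes)
  exact fun _ hx => mem_exteriorOf_of_mem_connectedComponentIn (he hy)
    (subset_connectedComponentIn hC hes heC (.inr hy) (.inl hx))

theorem not_openSquare_subset_interiorOf {C : Set (Sym2 Vertex)} {s : Square}
    (hs : openSquare s ⊆ exteriorOf C) : ¬ openSquare s ⊆ interiorOf C := fun h =>
  Set.disjoint_left.1 (disjoint_interiorOf_exteriorOf C) (h (center_mem_openSquare s))
    (hs (center_mem_openSquare s))

/-- An edge belongs to only two squares, so one shared by two squares off `K` is not in the graph of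
`K` and can be crossed without meeting `C`. -/
theorem openSquare_subset_of_reachable {K : Set Square} {C : Set (Sym2 Vertex)}
    (hC : C ⊆ (cornerGraph K).edgeSet) {s t : Square} (h : (occupiedGraph Kᶜ).Reachable s t)
    {x : ℝ × ℝ} (hs : openSquare s ⊆ connectedComponentIn (trace C)ᶜ x) :
    openSquare t ⊆ connectedComponentIn (trace C)ᶜ x := by
  obtain ⟨p⟩ := h
  induction p with
  | nil => exact hs
  | cons hadj p ih =>
    obtain ⟨hu, hv, hne, e, heu, hev⟩ := hadj
    refine ih (openSquare_subset_of_plusAdj (fun e he => ?_) heu hev (fun heC => ?_) hs)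
    · obtain ⟨s, -, hs⟩ := mem_edgeSet_cornerGraph.1 (hC he)
      exact .of_mem_squareEdges hs
    · obtain ⟨w, hw, hew⟩ := mem_edgeSet_cornerGraph.1 (hC heC)
      rcases eq_or_eq_of_mem_squareEdges hne heu hev hew with rfl | rfl
      exacts [hu hw, hv hw]

theorem InBox.openSquare_subset_exteriorOf {K : Set Square} {N : ℤ} (hN : InBox K N)
    {C : Set (Sym2 Vertex)} (hC : IsCycleIn (cornerGraph K) C) {t : Square}
    (ht : t ∈ outside K N) : openSquare t ⊆ exteriorOf C := by
  intro x hx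
  refine ⟨notMem_trace_of_mem_openSquare hC.isGridEdge hx, fun hb => ?_⟩
  have hsub : ∀ s ∈ outside K N, openSquare s ⊆ connectedComponentIn (trace C)ᶜ x := fun s hs =>
    openSquare_subset_of_reachable hC.subset_edgeSet (ht.2.trans hs.2.symm)
      (openSquare_subset_connectedComponentIn hC.isGridEdge hx)
  obtain ⟨R, hR⟩ := hb.image_fst.bddAbove
  -- A square to the right of both the box and the supposed bound `R`, yet in the same component of
  -- the complement of the curve.
  have hs : ((max (N + 1) (⌊R⌋ + 1), 0) : Square) ∈ outside K N :=
    hN.mem_outside (by simp only; omega)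
  have h1 := hR ⟨_, hsub _ hs (center_mem_openSquare _), rfl⟩
  have h2 := Int.lt_floor_add_one R
  have h3 : ((⌊R⌋ + 1 : ℤ) : ℝ) ≤ (max (N + 1) (⌊R⌋ + 1) : ℤ) := Int.cast_le.2 (le_max_right _ _)
  push_cast at h1 h3
  linarith

/-! ### The outermost boundary -/

theorem plusComponent_eq {occ : Set Square} (h0 : (0, 0) ∈ occ) :
    plusComponent occ = {t | t ∈ occ ∧ (occupiedGraph occ).Reachable t (0, 0)} := by
  ext t
  constructor
  · rintro ⟨-, h⟩
    refine ⟨?_, h.symm⟩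
    obtain ⟨p⟩ := h.symm
    cases p with
    | nil => exact h0
    | cons hadj _ => exact hadj.1
  · exact fun h => ⟨h0, h.2.symm⟩

theorem reachable_plusComponent {occ : Set Square} (h0 : (0, 0) ∈ occ) :
    ∀ s ∈ plusComponent occ, ∀ t ∈ plusComponent occ,
      (occupiedGraph (plusComponent occ)).Reachable s t := by
  rw [plusComponent_eq h0]
  exact fun s hs t ht => (reachable_occupiedGraph_component hs.2).trans
    (reachable_occupiedGraph_component ht.2).symm

theorem notMem_of_plusAdj_plusComponent {occ : Set Square} {s t : Square}
    (hs : s ∈ plusComponent occ) (ht : t ∉ plusComponent occ) (hst : PlusAdj s t) : t ∉ occ := by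
  intro hocc
  have hs' := hs
  rw [plusComponent_eq hs.1] at hs'
  have hadj : (occupiedGraph occ).Adj s t := ⟨hs'.1, hocc, hst⟩
  exact ht ⟨hs.1, hs.2.trans hadj.reachable⟩

/-- A neighbour of `outside K N` that is off `K` belongs to `outside K N`. Hence filling the holes
creates no boundary edge that is not an edge of `K`. -/
theorem mem_of_mem_edgeBoundary {K : Set Square} {N : ℤ} {e : Sym2 Vertex}
    (he : e ∈ edgeBoundary (outside K N)ᶜ) :
    ∃ s t, s ∈ K ∧ t ∈ outside K N ∧ PlusAdj s t ∧ e ∈ squareEdges s ∧ e ∈ squareEdges t := by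
  obtain ⟨s, t, hs, ht, hes, het⟩ := he
  have hadj : PlusAdj s t := ⟨fun h => ht (h ▸ hs), e, hes, het⟩
  rw [Set.notMem_compl_iff] at ht
  refine ⟨s, t, ?_, ht, hadj, hes, het⟩
  by_contra hsK
  exact hs (mem_outside_of_plusAdj hsK ht hadj)

theorem InBox.openEdge_subset_exteriorOf {K : Set Square} {N : ℤ} (hN : InBox K N)
    {C : Set (Sym2 Vertex)} (hC : IsCycleIn (cornerGraph K) C) {e : Sym2 Vertex}
    (he : e ∈ edgeBoundary (outside K N)ᶜ) (heC : e ∉ C) : openEdge e ⊆ exteriorOf C := by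
  obtain ⟨s, t, -, ht, -, -, het⟩ := mem_of_mem_edgeBoundary he
  exact PlusPercolation.openEdge_subset_exteriorOf hC.isGridEdge het heC
    (hN.openSquare_subset_exteriorOf hC ht)

theorem InBox.isCycleIn_edgeBoundary {K : Set Square} {N : ℤ} (hN : InBox K N)
    (hne : K.Nonempty) (hK : ∀ s ∈ K, ∀ t ∈ K, (occupiedGraph K).Reachable s t) :
    IsCycleIn (cornerGraph K) (edgeBoundary (outside K N)ᶜ) := by
  refine (PlusPercolation.isCycleIn_edgeBoundary hN.finite_compl_outside
    (hne.mono (subset_compl_outside K N)) (fun s hs t ht => hN.reachable_compl_outside hK hs ht)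
    fun s hs t ht => ?_).mono (SimpleGraph.fromEdgeSet_mono fun e he => ?_)
  · rw [compl_compl]
    exact reachable_outside (Set.notMem_compl_iff.1 hs) (Set.notMem_compl_iff.1 ht)
  · obtain ⟨s, -, hs, -, -, hes, -⟩ := mem_of_mem_edgeBoundary he
    exact Set.mem_biUnion hs hes

theorem InBox.outermostBoundary_eq {K : Set Square} {N : ℤ} (hN : InBox K N)
    (hne : K.Nonempty) (hK : ∀ s ∈ K, ∀ t ∈ K, (occupiedGraph K).Reachable s t) :
    outermostBoundary K = edgeBoundary (outside K N)ᶜ := by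
  ext e
  constructor
  · rintro ⟨heK, he⟩
    by_contra heB
    obtain ⟨s, hs, hes⟩ := mem_edgeSet_cornerGraph.1 heK
    -- The defining condition is tested on the edge boundary itself: an edge off it would put the
    -- adjacent square of `K` in its exterior, but that square is in its interior.
    have hB := hN.isCycleIn_edgeBoundary hne hK
    exact not_openSquare_subset_interiorOf
      (openSquare_subset_exteriorOf_of_openEdge hB.isGridEdge hes heB
        ((he _ hB).resolve_left heB))
      (openSquare_subset_interiorOf_edgeBoundary hN.finite_compl_outside
        (subset_compl_outside K N hs))
  · intro he
    obtain ⟨s, t, hs, -, -, hes, -⟩ := mem_of_mem_edgeBoundary he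
    exact ⟨mem_edgeSet_cornerGraph.2 ⟨s, hs, hes⟩, fun C hC =>
      or_iff_not_imp_left.2 (hN.openEdge_subset_exteriorOf hC he)⟩

end PlusPercolation

/-! ### The theorem on the outermost boundary -/

open PlusPercolation in
theorem theorem2 (occ : Set PlusPercolation.Square)
    (h0 : ((0, 0) : PlusPercolation.Square) ∈ occ)
    (hfin : (PlusPercolation.plusComponent occ).Finite) :
    PlusPercolation.IsCycleIn
        (PlusPercolation.cornerGraph (PlusPercolation.plusComponent occ))
        (PlusPercolation.outermostBoundary (PlusPercolation.plusComponent occ)) ∧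
      PlusPercolation.ContainsSquares (PlusPercolation.plusComponent occ)
        (PlusPercolation.outermostBoundary (PlusPercolation.plusComponent occ)) ∧
      PlusPercolation.SeparatesOccupiedFromVacant occ (PlusPercolation.plusComponent occ)
        (PlusPercolation.outermostBoundary (PlusPercolation.plusComponent occ)) ∧
      ∀ C : Set (Sym2 PlusPercolation.Vertex),
        PlusPercolation.IsCycleIn
            (PlusPercolation.cornerGraph (PlusPercolation.plusComponent occ)) C →
          PlusPercolation.ContainsSquares (PlusPercolation.plusComponent occ) C →
          PlusPercolation.SeparatesOccupiedFromVacant occ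
            (PlusPercolation.plusComponent occ) C →
          C = PlusPercolation.outermostBoundary (PlusPercolation.plusComponent occ) := by
  
  obtain ⟨N, hN⟩ := exists_inBox hfin
  have h0K : (0, 0) ∈ plusComponent occ := ⟨h0, .refl _⟩
  have hK := reachable_plusComponent h0
  rw [hN.outermostBoundary_eq ⟨_, h0K⟩ hK]
  have hB := hN.isCycleIn_edgeBoundary ⟨_, h0K⟩ hK
  have hint := fun s hs => openSquare_subset_interiorOf_edgeBoundary hN.finite_compl_outside
    (s := s) hs
  have hsub := subset_compl_outside (plusComponent occ) N
  refine ⟨hB, fun s hs => hint s (hsub hs), fun e he => ?_, fun C hC hCK hCsep => ?_⟩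
  · obtain ⟨s, t, hs, ht, hst, hes, het⟩ := mem_of_mem_edgeBoundary he
    have hsocc : s ∈ occ := ((plusComponent_eq h0).subset hs).1
    have htocc := notMem_of_plusAdj_plusComponent hs ht.1 hst
    exact ⟨⟨hB.subset_edgeSet he, ⟨s, hsocc, hes⟩, t, htocc, het⟩,
      ⟨s, hs, hsocc, hes, hint s (hsub hs)⟩, t, htocc, het, hN.openSquare_subset_exteriorOf hB ht⟩
  -- An edge of the boundary missing from `C` would lie in the exterior of `C`, together with the
  -- square of the component beside it, contrary to (i).
  · have hBC : edgeBoundary (outside (plusComponent occ) N)ᶜ ⊆ C := by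
      intro e he
      by_contra heC
      obtain ⟨s, t, hs, -, -, hes, -⟩ := mem_of_mem_edgeBoundary he
      exact not_openSquare_subset_interiorOf
        (openSquare_subset_exteriorOf_of_openEdge hC.isGridEdge hes heC
          (hN.openEdge_subset_exteriorOf hC he heC)) (hCK s hs)
    refine Set.Subset.antisymm (fun e he => ?_) hBC
    obtain ⟨-, ⟨s, hs, -, hes, -⟩, t, -, het, ht⟩ := hCsep e he
    -- The vacant square `t` is not in the filled set: otherwise it would be interior to the edge
    -- boundary, hence not exterior to the larger set `C`.
    exact ⟨s, t, hsub hs, fun htD => interiorOf_subset_of_subset hBC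
      (hint t htD (center_mem_openSquare t)) (ht (center_mem_openSquare t)), hes, het⟩
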